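/- Let $n>2$. An $n$-ary (polyadic) group is a non-empty set with an associative $n$-ary operation $f$ in which each equation $f(a_1,\dots,a_{i-1},x,a_{i+1},\dots,a_n)=c$ has a unique solution $x$; the skew element $\bar x$ is defined by $f(x,\dots,x,\bar x)=x$, and a polyadic subgroup is a non-empty subset closed under $f$ and $x\mapsto\bar x$. Let $(G,f)=\mathrm{der}_{\theta,b}(G,\cdot)$ be a polyadic group, that is, $(G,\cdot)$ is a group, $\theta$ is an automorphism of it, $b\in G$, $\theta(b)=b$, $\theta^{n-1}(x)=bxb^{-1}$ for all $x$, and $f(x_1,\dots,x_n)=x_1\theta(x_2)\cdots\theta^{n-1}(x_n)\,b$. Let $A\subseteq G$ be a set of coefficients: $A=G$ when arbitrary coefficients from $G$ are allowed, $A=\varnothing$ for coefficient-free equations. For variables $X=\{x_1,\dots,x_m\}$, $m\ge 1$, let $A[X]$ be the polyadic group of polyadic terms in $X$ with coefficients from $A$, presented by the generators $A\cup X$ and the relations $f(a_1,\dots,a_n)=a_0$ with $a_0,\dots,a_n\in A$ that hold in $G$ (so $G[X]$ is the free product of $(G,f)$ and the free polyadic group on $X$). An algebraic set $Y\subseteq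 G^m$ is the solution set of a system of equations $p\approx q$ with $p,q\in A[X]$; its coordinate polyadic group is $\Gamma(Y)=A[X]/\mathrm{Rad}(Y)$, where $\mathrm{Rad}(Y)$ consists of the pairs $(p,q)$ of terms that agree at all points of $Y$. Assume that $(G,f)$ is equational noetherian: every such system (in finitely many variables) has the same solutions as one of its finite subsystems. For a set $I$, let $(G,f)^I$ be the direct power, and for $u\in G^I$ let $(G^I)_u$ be the group on $G^I$ with the product $x u^{-1}y$. Then: (a) For every coordinate polyadic group $\Gamma(Y)$ of an algebraic set $Y$ there are a set $I$, an element $u=(u_i)_{i\in I}\in G^I$ and a polyadic subgroup $H$ of $(G,f)^I$ containing the constant families $(a)_{i\in I}$, $a\in A$, such that $\Gamma(Y)\cong H$ by an isomorphism of polyadic groups sending each coefficient $a$ to $(a)_{i\in I}$, and 1. $H$ is an ordinary subgroup of $(G^I)_u$; 2. for all $(h_i)_{i\in I}\in H$ we have $(u_i\theta(h_i)\theta(u_i)^{-1})_{i\in I}\in H$. (b) Conversely, let $I$ be a set, $u\in G^I$, and let $H$ be a polyadic subgroup of $(G,f)^I$ that contains the constant families $(a)_{i\in I}$, $a\in A$,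 satisfies 1 and 2, and is generated as a polyadic group by finitely many elements together with these constant families. Then $H$ is isomorphic, by an isomorphism respecting the coefficients as in (a), to $\Gamma(Y)$ for some algebraic set $Y\subseteq G^m$ and some $m\ge1$. -/

import Mathlib

universe u v w

/-- For an `n`-ary operation `f` and a sequence `x₀, x₁, …`, the element
`f(x₀, …, x_{i-1}, f(x_i, …, x_{i+n-1}), x_{i+n}, …, x_{2n-2})` (only `x₀, …, x_{2n-2}` matter). -/
def nest {n : ℕ} {G : Type u} (f : (Fin n → G) → G) (x : ℕ → G) (i : ℕ) : G :=
  f fun k => if k.val < i then x k else if k.val = i then f fun l => x (i + l) else x (k + n - 1)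

/-- An `n`-ary (polyadic) group, `n > 2`: a non-empty set with an associative `n`-ary operation
in which every equation in one unknown position has a unique solution. -/
structure PolyadicGroup (n : ℕ) (G : Type u) where
  two_lt : 2 < n
  nonempty : Nonempty G
  op : (Fin n → G) → G
  assoc : ∀ (x : ℕ → G) (i j : Fin n), nest op x i = nest op x j
  solv : ∀ (a : Fin n → G) (i : Fin n) (c : G), ∃! x, op (Function.update a i x) = c

/-- The operation `x₀ θ(x₁) θ²(x₂) ⋯ θ^{n-1}(x_{n-1}) b` of `der_{θ,b}(G, ·)`. -/
def derOp (n : ℕ) {G : Type u} [Group G] (θ : MulAut G) (b : G) (x : Fin n → G) : G :=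
  (List.ofFn fun k : Fin n => (θ ^ (k : ℕ)) (x k)).prod * b

/-- The set `G`, to carry the group structure of `G_u`. -/
def Twist {G : Type u} [Group G] (_u : G) : Type u := G

/-- The identity map `G → G_u`. -/
def Twist.of {G : Type u} [Group G] (u x : G) : Twist u := x

/-- The group `G_u`: the set `G` with the product `x u⁻¹ y`. -/
instance Twist.instGroup {G : Type u} [Group G] (u : G) : Group (Twist u) where
  mul (x y : G) := (x * u⁻¹ * y : G)
  one := (u : G)
  inv (x : G) := (u * x⁻¹ * u : G)
  mul_assoc (x y z : G) := by
    change (x * u⁻¹ * y * u⁻¹ * z : G) = (x * u⁻¹ * (y * u⁻¹ * z) : G)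
    group
  one_mul (x : G) := by
    change (u * u⁻¹ * x : G) = x
    group
  mul_one (x : G) := by
    change (x * u⁻¹ * u : G) = x
    group
  inv_mul_cancel (x : G) := by
    change (u * x⁻¹ * u * u⁻¹ * x : G) = u
    group

/-- The set `K` is (the underlying set of) a subgroup of the group `G_u`. -/
def IsSubgroupOfTwist {G : Type u} [Group G] (u : G) (K : Set G) : Prop :=
  ∃ L : Subgroup (Twist u), ∀ x : G, x ∈ K ↔ Twist.of u x ∈ L

/-- Polyadic words over variables `x₀, …, x_{m-1}` and a set `C` of constants, in the language
consisting of an `n`-ary operation and the unary operation `skew`. -/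
inductive PTerm (n : ℕ) (C : Type u) (m : ℕ) : Type u
  | const (c : C) : PTerm n C m
  | var (j : Fin m) : PTerm n C m
  | op (t : Fin n → PTerm n C m) : PTerm n C m
  | skew (t : PTerm n C m) : PTerm n C m

namespace PolyadicGroup

/-- The skew element of `x`: the unique `y` with `f(x, …, x, y) = x`. -/
noncomputable def skew {n : ℕ} {G : Type u} (P : PolyadicGroup n G) (x : G) : G :=
  (P.solv (fun _ => x) ⟨n - 1, by have := P.two_lt; omega⟩ x).choose

theorem op_skew {n : ℕ} {G : Type u} (P : PolyadicGroup n G) (x : G) (l : Fin n)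
    (hl : l.val + 1 = n) : P.op (Function.update (fun _ => x) l (P.skew x)) = x := by
  have h := (P.solv (fun _ => x) ⟨n - 1, by have := P.two_lt; omega⟩ x).choose_spec.1
  have e : l = ⟨n - 1, by have := P.two_lt; omega⟩ := Fin.ext (by simp; omega)
  rw [e]
  exact h

/-- `nest` computed from its inner block. -/
theorem nest_eq {n : ℕ} {G : Type u} (f : (Fin n → G) → G) (x : ℕ → G) (i : Fin n)
    (a y : Fin n → G) (z : G) (hy : ∀ l : Fin n, x (i + l) = y l) (hz : f y = z)
    (h1 : ∀ k : Fin n, k < i → x k = a k) (h2 : ∀ k : Fin n, i < k → x (k + n - 1) = a k) :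
    nest f x i = f (Function.update a i z) := by
  unfold nest
  congr 1
  funext k
  rcases lt_trichotomy k i with h | h | h
  · have h' : k.val < i.val := h
    rw [if_pos h', Function.update_of_ne h.ne, h1 k h]
  · subst h
    simp only [lt_irrefl, if_false, if_true, Function.update_self]
    rw [← hz]
    congr 1
    funext l
    exact hy l
  · have h' : i.val < k.val := h
    rw [if_neg (by omega), if_neg (by omega), Function.update_of_ne h.ne', h2 k h]

theorem op_skew_at {n : ℕ} {G : Type u} (P : PolyadicGroup n G) (x : G) (j : Fin n) :
    P.op (Function.update (fun _ => x) j (P.skew x)) = x := by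
  have hn := P.two_lt
  have hj := j.isLt
  let s : ℕ → G := fun t => if t = n - 1 then P.skew x else x
  have e1 : nest P.op s (⟨0, by omega⟩ : Fin n) =
      P.op (Function.update (fun _ => x) ⟨0, by omega⟩ x) := by
    refine nest_eq _ _ _ _ (Function.update (fun _ => x) ⟨n - 1, by omega⟩ (P.skew x)) _
      ?_ (P.op_skew x _ (by simp; omega)) ?_ ?_
    · intro l
      simp [s, Function.update_apply, Fin.ext_iff]
    · intro k hk
      exact absurd hk (by simp [Fin.lt_def])
    · intro k hk
      have : 0 < k.val := hk
      simp only [s]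
      rw [if_neg (by omega)]
  have e2 : nest P.op s (⟨n - 1 - j, by omega⟩ : Fin n) =
      P.op (Function.update (fun _ => x) ⟨n - 1 - j, by omega⟩
        (P.op (Function.update (fun _ => x) j (P.skew x)))) := by
    refine nest_eq _ _ _ _ (Function.update (fun _ => x) j (P.skew x)) _ ?_ rfl ?_ ?_
    · intro l
      simp only [s, Function.update_apply, Fin.ext_iff]
      refine if_congr ?_ rfl rfl
      omega
    · intro k hk
      have : k.val < n - 1 - j := hk
      simp only [s]
      rw [if_neg (by omega)]
    · intro k hk
      have : n - 1 - j < k.val := hk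
      simp only [s]
      rw [if_neg (by omega)]
  have e := (e2.symm.trans (P.assoc s _ _)).trans e1
  refine (P.solv (fun _ => x) ⟨n - 1 - j, by omega⟩ (P.op fun _ => x)).unique ?_ ?_
  · refine e.trans ?_
    simp
  · simp

/-- `f(x, …, skew x, …, x, y) = y`. -/
theorem dornte_left {n : ℕ} {G : Type u} (P : PolyadicGroup n G) (x y : G) (j l : Fin n)
    (hl : l.val + 1 = n) (hj : j ≠ l) :
    P.op (Function.update (Function.update (fun _ => x) j (P.skew x)) l y) = y := by
  have hn := P.two_lt
  have hjl : j.val < l.val := by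
    have := j.isLt
    have : j.val ≠ l.val := fun h => hj (Fin.ext h)
    omega
  obtain ⟨z, hz, -⟩ := P.solv (fun _ => x) l y
  let s : ℕ → G := fun t => if t = j then P.skew x else if t = 2 * n - 2 then z else x
  have e1 : nest P.op s l =
      P.op (Function.update (Function.update (fun _ => x) j (P.skew x)) l y) := by
    refine nest_eq _ _ _ _ (Function.update (fun _ => x) l z) _ ?_ hz ?_ ?_
    · intro t
      simp only [s, Function.update_apply, Fin.ext_iff]
      rw [if_neg (by omega)]
      refine if_congr ?_ rfl rfl
      omega
    · intro k hk
      have : k.val < l.val := hk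
      simp only [s, Function.update_apply, Fin.ext_iff]
      rw [if_neg (show ¬ (k.val = 2 * n - 2) by omega)]
    · intro k hk
      have : l.val < k.val := hk
      have := k.isLt
      omega
  have e2 : nest P.op s (⟨0, by omega⟩ : Fin n) =
      P.op (Function.update (Function.update (fun _ => x) l z) ⟨0, by omega⟩ x) := by
    refine nest_eq _ _ _ _ (Function.update (fun _ => x) j (P.skew x)) _ ?_
      (P.op_skew_at x j) ?_ ?_
    · intro t
      have := t.isLt
      simp only [s, Function.update_apply, Fin.ext_iff, zero_add]
      rw [if_neg (show ¬ (t.val = 2 * n - 2) by omega)]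
    · intro k hk
      exact absurd hk (by simp [Fin.lt_def])
    · intro k hk
      have : 0 < k.val := hk
      have := k.isLt
      simp only [s, Function.update_apply, Fin.ext_iff]
      rw [if_neg (by omega)]
      refine if_congr ?_ rfl rfl
      omega
  rw [← e1, P.assoc s l ⟨0, by omega⟩, e2]
  rw [Function.update_comm (by simp [Fin.ext_iff]; omega)]
  simpa using hz

/-- `f(y, x, …, skew x, …, x) = y`. -/
theorem dornte_right {n : ℕ} {G : Type u} (P : PolyadicGroup n G) (x y : G) (j l : Fin n)
    (hl : l.val = 0) (hj : j ≠ l) :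
    P.op (Function.update (Function.update (fun _ => x) j (P.skew x)) l y) = y := by
  have hn := P.two_lt
  have hjn := j.isLt
  have hjl : 0 < j.val := by
    have : j.val ≠ l.val := fun h => hj (Fin.ext h)
    omega
  obtain ⟨z, hz, -⟩ := P.solv (fun _ => x) l y
  let s : ℕ → G := fun t => if t = j + n - 1 then P.skew x else if t = 0 then z else x
  have e1 : nest P.op s l =
      P.op (Function.update (Function.update (fun _ => x) j (P.skew x)) l y) := by
    refine nest_eq _ _ _ _ (Function.update (fun _ => x) l z) _ ?_ hz ?_ ?_
    · intro t
      have := t.isLt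
      simp only [s, Function.update_apply, Fin.ext_iff]
      rw [if_neg (by omega)]
      refine if_congr ?_ rfl rfl
      omega
    · intro k hk
      have : k.val < l.val := hk
      omega
    · intro k hk
      have : l.val < k.val := hk
      simp only [s, Function.update_apply, Fin.ext_iff]
      rw [if_neg (show ¬ (k.val + n - 1 = 0) by omega)]
      refine if_congr ?_ rfl rfl
      omega
  have e2 : nest P.op s (⟨n - 1, by omega⟩ : Fin n) =
      P.op (Function.update (Function.update (fun _ => x) l z) ⟨n - 1, by omega⟩ x) := by
    refine nest_eq _ _ _ _ (Function.update (fun _ => x) j (P.skew x)) _ ?_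
      (P.op_skew_at x j) ?_ ?_
    · intro t
      have := t.isLt
      simp only [s, Function.update_apply, Fin.ext_iff]
      rw [if_neg (show ¬ (n - 1 + t.val = 0) by omega)]
      refine if_congr ?_ rfl rfl
      omega
    · intro k hk
      have : k.val < n - 1 := hk
      simp only [s, Function.update_apply, Fin.ext_iff]
      rw [if_neg (by omega)]
      refine if_congr ?_ rfl rfl
      omega
    · intro k hk
      have : n - 1 < k.val := hk
      have := k.isLt
      omega
  rw [← e1, P.assoc s l ⟨n - 1, by omega⟩, e2]
  rw [Function.update_comm (by simp [Fin.ext_iff]; omega)]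
  simpa using hz

/-- The direct power `(G, f)^I`, with componentwise operation. -/
def pi {n : ℕ} {G : Type u} (P : PolyadicGroup n G) (I : Type v) : PolyadicGroup n (I → G) where
  two_lt := P.two_lt
  nonempty := ⟨fun _ => P.nonempty.some⟩
  op x := fun i => P.op fun k => x k i
  assoc x k l := by
    have key : ∀ (k : ℕ) (i : I), nest (fun (x : Fin n → I → G) i => P.op fun k => x k i) x k i =
        nest P.op (fun t => x t i) k := by
      intro k i
      simp only [nest]
      congr 1
      funext t
      split_ifs <;> rfl
    funext i
    rw [key, key]
    exact P.assoc _ k l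
  solv a k c := by
    have key : ∀ (x : I → G) (i : I), (fun t => (Function.update a k x) t i) =
        Function.update (fun t => a t i) k (x i) := by
      intro x i
      funext t
      by_cases h : t = k
      · subst h
        simp
      · simp [h]
    choose x hx hx' using fun i => P.solv (fun t => a t i) k (c i)
    refine ⟨x, funext fun i => ?_, fun y hy => funext fun i => hx' i _ ?_⟩
    · simp only [key]
      exact hx i
    · have := congrFun hy i
      simp only [key] at this
      exact this

/-- Polyadic subgroups: non-empty subsets closed under the operation and the skew operation. -/
def IsPolyadicSubgroup {n : ℕ} {H : Type u} (P : PolyadicGroup n H) (K : Set H) : Prop :=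
  K.Nonempty ∧ (∀ x : Fin n → H, (∀ k, x k ∈ K) → P.op x ∈ K) ∧ ∀ x ∈ K, P.skew x ∈ K

/-- The elements obtained from a set `S` by the operation and the skew operation. -/
inductive InClosure {n : ℕ} {H : Type u} (P : PolyadicGroup n H) (S : Set H) : H → Prop
  | mem (x : H) (hx : x ∈ S) : InClosure P S x
  | op (x : Fin n → H) (hx : ∀ k, InClosure P S (x k)) : InClosure P S (P.op x)
  | skew (x : H) (hx : InClosure P S x) : InClosure P S (P.skew x)

/-- `K` is generated, as a polyadic group, by the set `D` together with finitely many elements. -/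
def FinitelyGeneratedOver {n : ℕ} {H : Type u} (P : PolyadicGroup n H) (D K : Set H) : Prop :=
  ∃ S : Set H, S.Finite ∧ {x | P.InClosure (S ∪ D) x} = K

/-- Equality of polyadic words in the free product of (the polyadic group on) `A ⊆ G` and the free
polyadic group on `x₀, …, x_{m-1}`: the congruence generated by the identities defining the
variety of polyadic groups in the language `(f, skew)` and by the multiplication table of `A`. -/
inductive WordRel {n : ℕ} {G : Type u} (P : PolyadicGroup n G) (A : Set G) (m : ℕ) :
    PTerm n A m → PTerm n A m → Prop
  | refl (p) : WordRel P A m p p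
  | symm (p q) : WordRel P A m p q → WordRel P A m q p
  | trans (p q r) : WordRel P A m p q → WordRel P A m q r → WordRel P A m p r
  | op (p q : Fin n → PTerm n A m) : (∀ k, WordRel P A m (p k) (q k)) →
      WordRel P A m (PTerm.op p) (PTerm.op q)
  | skew (p q) : WordRel P A m p q → WordRel P A m (PTerm.skew p) (PTerm.skew q)
  | assoc (x : ℕ → PTerm n A m) (i j : Fin n) :
      WordRel P A m (nest PTerm.op x i) (nest PTerm.op x j)
  | left (x y : PTerm n A m) (j l : Fin n) (hl : l.val + 1 = n) (hj : j ≠ l) :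
      WordRel P A m
        (PTerm.op (Function.update (Function.update (fun _ => x) j (PTerm.skew x)) l y)) y
  | right (x y : PTerm n A m) (j l : Fin n) (hl : l.val = 0) (hj : j ≠ l) :
      WordRel P A m
        (PTerm.op (Function.update (Function.update (fun _ => x) j (PTerm.skew x)) l y)) y
  | table (a : Fin n → A) (c : A) (h : P.op (fun k => (a k : G)) = c) :
      WordRel P A m (PTerm.op fun k => PTerm.const (a k)) (PTerm.const c)

/-- The polyadic group `A[X]`, `X = {x₀, …, x_{m-1}}`, of polyadic terms with coefficients from
`A ⊆ G`. For `A = G` it is the free product `G[X]` of `(G, f)` and the free polyadic group on `X`;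
for `A = ∅` it is the free polyadic group on `X`. -/
def PolyTerm {n : ℕ} {G : Type u} (P : PolyadicGroup n G) (A : Set G) (m : ℕ) : Type u :=
  Quotient (⟨WordRel P A m, ⟨WordRel.refl, WordRel.symm _ _, WordRel.trans _ _ _⟩⟩ :
    Setoid (PTerm n A m))

/-- The class of a word in `A[X]`. -/
def PolyTerm.mk {n : ℕ} {G : Type u} (P : PolyadicGroup n G) (A : Set G) {m : ℕ}
    (p : PTerm n A m) : PolyTerm P A m :=
  Quotient.mk _ p

/-- The `n`-ary operation of `A[X]`. -/
noncomputable def PolyTerm.op {n : ℕ} {G : Type u} {P : PolyadicGroup n G} {A : Set G} {m : ℕ}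
    (p : Fin n → PolyTerm P A m) : PolyTerm P A m :=
  PolyTerm.mk P A (PTerm.op fun k => Quotient.out (p k))

theorem PolyTerm.op_mk {n : ℕ} {G : Type u} {P : PolyadicGroup n G} {A : Set G} {m : ℕ}
    (p : Fin n → PTerm n A m) :
    PolyTerm.op (fun k => PolyTerm.mk P A (p k)) = PolyTerm.mk P A (PTerm.op p) :=
  Quotient.sound (WordRel.op _ _ fun k => Quotient.exact (Quotient.out_eq (PolyTerm.mk P A (p k))))

/-- The value of a word at the point `g ∈ G^m`. -/
noncomputable def wordEval {n : ℕ} {G : Type u} (P : PolyadicGroup n G) (A : Set G) {m : ℕ}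
    (g : Fin m → G) : PTerm n A m → G
  | PTerm.const c => c
  | PTerm.var j => g j
  | PTerm.op t => P.op fun k => wordEval P A g (t k)
  | PTerm.skew t => P.skew (wordEval P A g t)

theorem wordEval_sound {n : ℕ} {G : Type u} (P : PolyadicGroup n G) (A : Set G) {m : ℕ}
    (g : Fin m → G) {p q : PTerm n A m} (h : WordRel P A m p q) :
    wordEval P A g p = wordEval P A g q := by
  have hnest : ∀ (x : ℕ → PTerm n A m) (i : ℕ), wordEval P A g (nest PTerm.op x i) =
      nest P.op (fun t => wordEval P A g (x t)) i := by
    intro x i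
    simp only [nest, wordEval]
    congr 1
    funext k
    split_ifs <;> simp [wordEval]
  have hupd : ∀ (x y : PTerm n A m) (j l : Fin n),
      wordEval P A g
        (PTerm.op (Function.update (Function.update (fun _ => x) j (PTerm.skew x)) l y)) =
      P.op (Function.update (Function.update (fun _ => wordEval P A g x) j
        (P.skew (wordEval P A g x))) l (wordEval P A g y)) := by
    intro x y j l
    simp only [wordEval]
    congr 1
    funext k
    simp only [Function.update_apply]
    split_ifs <;> simp [wordEval]
  induction h with
  | refl p => rfl
  | symm p q _ ih => exact ih.symm
  | trans p q r _ _ ih1 ih2 => exact ih1.trans ih2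
  | op p q _ ih =>
    simp only [wordEval]
    congr 1
    funext k
    exact ih k
  | skew p q _ ih => simp only [wordEval, ih]
  | assoc x i j =>
    rw [hnest, hnest]
    exact P.assoc _ i j
  | left x y j l hl hj =>
    rw [hupd]
    exact P.dornte_left _ _ j l hl hj
  | right x y j l hl hj =>
    rw [hupd]
    exact P.dornte_right _ _ j l hl hj
  | table a c h => simpa only [wordEval] using h

/-- The value `p(g₁, …, g_m)` of a polyadic term at a point of `G^m`. -/
noncomputable def PolyTerm.eval {n : ℕ} {G : Type u} {P : PolyadicGroup n G} {A : Set G} {m : ℕ}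
    (g : Fin m → G) (p : PolyTerm P A m) : G :=
  Quotient.lift (wordEval P A g) (fun _ _ h => wordEval_sound P A g h) p

theorem PolyTerm.eval_mk {n : ℕ} {G : Type u} {P : PolyadicGroup n G} {A : Set G} {m : ℕ}
    (g : Fin m → G) (p : PTerm n A m) : (PolyTerm.mk P A p).eval g = wordEval P A g p :=
  rfl

theorem PolyTerm.eval_op {n : ℕ} {G : Type u} {P : PolyadicGroup n G} {A : Set G} {m : ℕ}
    (g : Fin m → G) (p : Fin n → PolyTerm P A m) :
    (PolyTerm.op p).eval g = P.op fun k => (p k).eval g := by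
  have h : ∀ k, (p k).eval g = wordEval P A g (Quotient.out (p k)) := fun k => by
    conv_lhs => rw [← Quotient.out_eq (p k)]
    rfl
  simp only [h]
  rfl

/-- The solution set in `G^m` of a system of polyadic equations `p ≈ q` with coefficients
from `A`. -/
def solutionSet {n : ℕ} {G : Type u} (P : PolyadicGroup n G) (A : Set G) {m : ℕ}
    (S : Set (PolyTerm P A m × PolyTerm P A m)) : Set (Fin m → G) :=
  {g | ∀ e ∈ S, e.1.eval g = e.2.eval g}

/-- Algebraic sets (for equations with coefficients from `A`). -/
def IsAlgebraicSet {n : ℕ} {G : Type u} (P : PolyadicGroup n G) (A : Set G) {m : ℕ}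
    (Y : Set (Fin m → G)) : Prop :=
  ∃ S : Set (PolyTerm P A m × PolyTerm P A m), Y = P.solutionSet A S

/-- Every system of equations with coefficients from `A`, in finitely many variables, has the same
solutions as one of its finite subsystems. -/
def EquationalNoetherian {n : ℕ} {G : Type u} (P : PolyadicGroup n G) (A : Set G) : Prop :=
  ∀ (m : ℕ) (S : Set (PolyTerm P A m × PolyTerm P A m)),
    ∃ S₀ ⊆ S, S₀.Finite ∧ P.solutionSet A S = P.solutionSet A S₀

/-- The radical `Rad(Y)`: the congruence on `A[X]` of all pairs of terms that agree on `Y`. -/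
def radical {n : ℕ} {G : Type u} (P : PolyadicGroup n G) (A : Set G) {m : ℕ}
    (Y : Set (Fin m → G)) : Setoid (PolyTerm P A m) where
  r p q := ∀ g ∈ Y, p.eval g = q.eval g
  iseqv := ⟨fun _ _ _ => rfl, fun h g hg => (h g hg).symm,
    fun h h' g hg => (h g hg).trans (h' g hg)⟩

/-- The coordinate polyadic group `Γ(Y) = A[X]/Rad(Y)`. -/
def Coord {n : ℕ} {G : Type u} (P : PolyadicGroup n G) (A : Set G) {m : ℕ}
    (Y : Set (Fin m → G)) : Type u :=
  Quotient (P.radical A Y)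

/-- The class of a polyadic term in the coordinate polyadic group. -/
def Coord.mk {n : ℕ} {G : Type u} (P : PolyadicGroup n G) (A : Set G) {m : ℕ}
    (Y : Set (Fin m → G)) (p : PolyTerm P A m) : P.Coord A Y :=
  Quotient.mk _ p

/-- The `n`-ary operation of the coordinate polyadic group. -/
noncomputable def Coord.op {n : ℕ} {G : Type u} {P : PolyadicGroup n G} {A : Set G} {m : ℕ}
    {Y : Set (Fin m → G)} (p : Fin n → P.Coord A Y) : P.Coord A Y :=
  Coord.mk P A Y (PolyTerm.op fun k => Quotient.out (p k))

theorem Coord.op_mk {n : ℕ} {G : Type u} {P : PolyadicGroup n G} {A : Set G} {m : ℕ}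
    {Y : Set (Fin m → G)} (p : Fin n → PolyTerm P A m) :
    Coord.op (fun k => Coord.mk P A Y (p k)) = Coord.mk P A Y (PolyTerm.op p) := by
  refine Quotient.sound fun g hg => ?_
  rw [PolyTerm.eval_op, PolyTerm.eval_op]
  congr 1
  funext k
  exact Quotient.exact (Quotient.out_eq (Coord.mk P A Y (p k))) g hg

/-- The image in `Γ(Y)` of a coefficient `a ∈ A`. -/
def Coord.const {n : ℕ} {G : Type u} (P : PolyadicGroup n G) (A : Set G) {m : ℕ}
    (Y : Set (Fin m → G)) (a : A) : P.Coord A Y :=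
  Coord.mk P A Y (PolyTerm.mk P A (PTerm.const a))

/-- The constant families `(a)_{i ∈ I}`, `a ∈ A`, in `G^I`. -/
def constants {G : Type u} (A : Set G) (I : Type v) : Set (I → G) :=
  {x | ∃ a ∈ A, x = fun _ => a}

/-- `Γ(Y)` is isomorphic to the subset `K ⊆ G^I` with the componentwise operation, by an
isomorphism that sends each coefficient `a ∈ A` to the constant family `(a)_{i ∈ I}`. -/
def CoordIso {n : ℕ} {G : Type u} (P : PolyadicGroup n G) (A : Set G) {m : ℕ}
    (Y : Set (Fin m → G)) {I : Type v} (K : Set (I → G)) : Prop :=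
  ∃ φ : P.Coord A Y ≃ K,
    (∀ p : Fin n → P.Coord A Y, (φ (Coord.op p) : I → G) = (P.pi I).op fun k => (φ (p k) : I → G)) ∧
    ∀ a : A, (φ (Coord.const P A Y a) : I → G) = fun _ => (a : G)

/-- `K` is a polyadic subgroup of `(G, f)^I` containing the coefficients from `A`, a subgroup of
the ordinary group `(G^I)_u`, and invariant under `h ↦ (u_i θ(h_i) θ(u_i)⁻¹)_i`. -/
def HasTwistedForm {n : ℕ} {G : Type u} [Group G] (P : PolyadicGroup n G) (A : Set G)
    (θ : MulAut G) {I : Type v} (u : I → G) (K : Set (I → G)) : Prop :=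
  (P.pi I).IsPolyadicSubgroup K ∧ constants A I ⊆ K ∧ IsSubgroupOfTwist u K ∧
    ∀ h ∈ K, (fun i => u i * θ (h i) * (θ (u i))⁻¹) ∈ K

end PolyadicGroup

/-! Conditions 1 and 2 hold for every polyadic subgroup `H` of the power and every `u ∈ H`, because
both maps involved are polyadic terms. By Dörnte's identity `f(u, …, ū, …, u, y) = y`, and
exchanging the first `u` for `x` multiplies the value on the left by `x u⁻¹`, so `x u⁻¹ y` is a
value of `f`. Likewise `f(u, …, u, ū) = u`, and exchanging the second `u` for `h` gives `u θ(h)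
θ(u)⁻¹` (`op_eq_mul_inv_mul`, `op_eq_twist`).

The rest is a dictionary between coordinate groups and families of points. Evaluating terms at a
family `(g_i)` in `G^m` maps `A[X]` onto a polyadic subgroup of `G^I`, and this map induces an
embedding of `Γ(Y)` as soon as its kernel is `Rad(Y)` (`coordIso_range_evalFamily`). For (a) the
family consists of all points of `Y`. For (b) the `i`-th components of the generators of `H` form
the point `g_i`, and `Y` is the Zariski closure of these points. -/

/-! ### Varying one argument of the derived operation. -/

/-- Changing the first argument of `derOp`. -/
theorem derOp_update_zero {n : ℕ} {G : Type u} [Group G] (θ : MulAut G) (b : G)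
    (x : Fin n → G) (l : Fin n) (hl : l.val = 0) (y : G) :
    derOp n θ b (Function.update x l y) = y * (x l)⁻¹ * derOp n θ b x := by
  obtain ⟨k, rfl⟩ : ∃ k, n = k + 1 := ⟨n - 1, by have := l.isLt; omega⟩
  obtain rfl : l = 0 := Fin.ext hl
  simp [derOp, List.ofFn_succ, mul_assoc]

/-- Changing the second argument of `derOp`. -/
theorem derOp_update_one {n : ℕ} {G : Type u} [Group G] (θ : MulAut G) (b : G)
    (x : Fin n → G) (z l : Fin n) (hz : z.val = 0) (hl : l.val = 1) (y : G) :
    derOp n θ b (Function.update x l y) =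
      x z * θ y * (θ (x l))⁻¹ * (x z)⁻¹ * derOp n θ b x := by
  obtain ⟨k, rfl⟩ : ∃ k, n = k + 2 := ⟨n - 2, by have := l.isLt; omega⟩
  obtain rfl : z = 0 := Fin.ext hz
  obtain rfl : l = Fin.succ 0 := Fin.ext hl
  have h (i : Fin k) : Function.update x (Fin.succ 0) y i.succ.succ = x i.succ.succ :=
    Function.update_of_ne (by simp [Fin.ext_iff]) _ _
  have h0 : Function.update x (Fin.succ 0) y 0 = x 0 :=
    Function.update_of_ne (by simp) _ _
  simp only [derOp, List.ofFn_succ, h, h0, Function.update_self, List.prod_cons]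
  simp [mul_assoc]

namespace PolyadicGroup

theorem skew_unique {n : ℕ} {G : Type u} (P : PolyadicGroup n G) (x y : G) (l : Fin n)
    (hl : l.val + 1 = n) (h : P.op (Function.update (fun _ => x) l y) = x) : y = P.skew x :=
  (P.solv (fun _ => x) l x).unique h (P.op_skew x l hl)

theorem pi_op_apply {n : ℕ} {G : Type u} (P : PolyadicGroup n G) {I : Type v}
    (x : Fin n → I → G) (i : I) : (P.pi I).op x i = P.op fun k => x k i :=
  rfl

theorem update_apply_apply {n : ℕ} {G : Type u} {I : Type v} (a : Fin n → I → G) (k : Fin n)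
    (x : I → G) (i : I) :
    (fun t => Function.update a k x t i) = Function.update (fun t => a t i) k (x i) := by
  funext t
  simp only [Function.update_apply]
  split_ifs <;> rfl

/-- The skew operation of a direct power is componentwise. -/
theorem pi_skew {n : ℕ} {G : Type u} (P : PolyadicGroup n G) {I : Type v} (x : I → G) :
    (P.pi I).skew x = fun i => P.skew (x i) := by
  have hn := P.two_lt
  symm
  refine (P.pi I).skew_unique x _ ⟨n - 1, by omega⟩ (by simp; omega) ?_
  funext i
  rw [pi_op_apply, update_apply_apply]
  exact P.op_skew (x i) _ (by simp; omega)

/-! ### Polyadic subgroups of powers as ordinary subgroups of twisted groups. -/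

section Derived

variable {n : ℕ} {G : Type u} [Group G] {θ : MulAut G} {b : G} {P : PolyadicGroup n G}

/-- With `u` in first place the value is `y` by `dornte_left`; in the derived form the first factor
stands leftmost and untwisted, so replacing it by `x` contributes exactly `x u⁻¹`. -/
theorem op_eq_mul_inv_mul (hP : ∀ x, P.op x = derOp n θ b x) (x u y : G) (z j l : Fin n)
    (hz : z.val = 0) (hl : l.val + 1 = n) (hjz : j ≠ z) (hjl : j ≠ l) :
    P.op (Function.update (Function.update (Function.update (fun _ => u) j (P.skew u)) l y) z x) =
      x * u⁻¹ * y := by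
  have hn := P.two_lt
  have hzl : z ≠ l := fun h => by rw [h] at hz; omega
  have h := P.dornte_left u y j l hl hjl
  rw [hP] at h ⊢
  rw [derOp_update_zero _ _ _ _ hz, h, Function.update_of_ne hzl, Function.update_of_ne hjz.symm]

/-- Replacing the second `u` in `f(u, …, u, ū) = u` multiplies on the left by `u θ(h) θ(u)⁻¹ u⁻¹`,
and the final `u⁻¹` cancels against the old value. As `n > 2`, the second place is not the one
holding `ū`. -/
theorem op_eq_twist (hP : ∀ x, P.op x = derOp n θ b x) (u h : G) (o l : Fin n)
    (ho : o.val = 1) (hl : l.val + 1 = n) :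
    P.op (Function.update (Function.update (fun _ => u) l (P.skew u)) o h) =
      u * θ h * (θ u)⁻¹ := by
  have hn := P.two_lt
  have hol : o ≠ l := fun h => by rw [h] at ho; omega
  have e := P.op_skew u l hl
  rw [hP] at e ⊢
  have hzl : (⟨0, by omega⟩ : Fin n) ≠ l := fun h => by rw [← h] at hl; simp at hl; omega
  rw [derOp_update_one θ b _ ⟨0, by omega⟩ o rfl ho, e, Function.update_of_ne hol,
    Function.update_of_ne hzl]
  simp

theorem IsPolyadicSubgroup.mul_inv_mul_mem (hP : ∀ x, P.op x = derOp n θ b x) {I : Type v} {K : Set (I → G)}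
    (hK : (P.pi I).IsPolyadicSubgroup K) {x u y : I → G} (hx : x ∈ K) (hu : u ∈ K) (hy : y ∈ K) :
    x * u⁻¹ * y ∈ K := by
  have hn := P.two_lt
  -- The three places `0`, `1`, `n - 1` for `x`, `ū`, `y` are distinct because `n > 2`.
  have e : x * u⁻¹ * y = (P.pi I).op (Function.update (Function.update (Function.update
      (fun _ => u) ⟨1, by omega⟩ ((P.pi I).skew u)) ⟨n - 1, by omega⟩ y) ⟨0, by omega⟩ x) := by
    funext i
    rw [pi_op_apply, update_apply_apply, update_apply_apply, update_apply_apply, pi_skew,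
      op_eq_mul_inv_mul hP]
    · rfl
    · rfl
    · simp only; omega
    · simp [Fin.ext_iff]
    · simp only [ne_eq, Fin.ext_iff]; omega
  rw [e]
  refine hK.2.1 _ fun k => ?_
  simp only [Function.update_apply]
  split_ifs
  exacts [hx, hy, hK.2.2 u hu, hu]

theorem IsPolyadicSubgroup.twist_mem (hP : ∀ x, P.op x = derOp n θ b x) {I : Type v}
    {K : Set (I → G)} (hK : (P.pi I).IsPolyadicSubgroup K) {u h : I → G} (hu : u ∈ K)
    (hh : h ∈ K) : (fun i => u i * θ (h i) * (θ (u i))⁻¹) ∈ K := by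
  have hn := P.two_lt
  have e : (fun i => u i * θ (h i) * (θ (u i))⁻¹) = (P.pi I).op (Function.update
      (Function.update (fun _ => u) ⟨n - 1, by omega⟩ ((P.pi I).skew u)) ⟨1, by omega⟩ h) := by
    funext i
    rw [pi_op_apply, update_apply_apply, update_apply_apply, pi_skew, op_eq_twist hP]
    · rfl
    · simp only; omega
  rw [e]
  refine hK.2.1 _ fun k => ?_
  simp only [Function.update_apply]
  split_ifs
  exacts [hh, hK.2.2 u hu, hu]

/-- A polyadic subgroup of a power of a derived polyadic group is a subgroup of `(G^I)_u` for each
of its elements `u`. -/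
theorem IsPolyadicSubgroup.isSubgroupOfTwist (hP : ∀ x, P.op x = derOp n θ b x) {I : Type v} {K : Set (I → G)}
    (hK : (P.pi I).IsPolyadicSubgroup K) {u : I → G} (hu : u ∈ K) : IsSubgroupOfTwist u K :=
  ⟨{ carrier := K
     -- The product `x u⁻¹ y` and the inverse `u x⁻¹ u` of `(G^I)_u` are both instances of the
     -- ternary map `(x, y, z) ↦ x y⁻¹ z`, and `u` is the identity.
     mul_mem' := fun hx hy => hK.mul_inv_mul_mem hP hx hu hy
     one_mem' := hu
     inv_mem' := fun hx => hK.mul_inv_mul_mem hP hu hx hu }, fun _ => Iff.rfl⟩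

end Derived

/-! ### Evaluation of terms at families of points, and coordinate groups. -/

section Evaluation

variable {n : ℕ} {G : Type u} (P : PolyadicGroup n G) (A : Set G) {m : ℕ} {I : Type v}

/-- The family of values of a polyadic term at a family of points of `G^m`. -/
noncomputable def evalFamily (g : I → Fin m → G) (p : PolyTerm P A m) : I → G :=
  fun i => p.eval (g i)

theorem evalFamily_op (g : I → Fin m → G) (p : Fin n → PolyTerm P A m) :
    P.evalFamily A g (PolyTerm.op p) = (P.pi I).op fun k => P.evalFamily A g (p k) :=
  funext fun i => PolyTerm.eval_op (g i) p

theorem evalFamily_mk_skew (g : I → Fin m → G) (t : PTerm n A m) :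
    P.evalFamily A g (PolyTerm.mk P A t.skew) =
      (P.pi I).skew (P.evalFamily A g (PolyTerm.mk P A t)) := by
  rw [pi_skew]
  rfl

theorem range_evalFamily_isPolyadicSubgroup (hm : 0 < m) (g : I → Fin m → G) :
    (P.pi I).IsPolyadicSubgroup (Set.range (P.evalFamily A g)) := by
  -- A variable supplies a term even when `A` is empty.
  refine ⟨⟨_, PolyTerm.mk P A (PTerm.var ⟨0, hm⟩), rfl⟩, fun x hx => ?_, ?_⟩
  · choose p hp using hx
    exact ⟨PolyTerm.op p, by rw [evalFamily_op]; simp only [hp]⟩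
  · rintro _ ⟨p, rfl⟩
    -- The skew operation is formed on words, so a representative of the term is chosen.
    induction p using Quotient.ind with
    | _ t => exact ⟨PolyTerm.mk P A t.skew, P.evalFamily_mk_skew A g t⟩

theorem constants_subset_range_evalFamily (g : I → Fin m → G) :
    constants A I ⊆ Set.range (P.evalFamily A g) := by
  rintro _ ⟨a, ha, rfl⟩
  exact ⟨PolyTerm.mk P A (PTerm.const ⟨a, ha⟩), rfl⟩

/-- The families of values at a family of points form the polyadic subgroup generated by the
coordinate families and the constants. -/
theorem range_evalFamily_eq_closure (g : I → Fin m → G) :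
    Set.range (P.evalFamily A g) =
      {x | (P.pi I).InClosure (Set.range (fun j i => g i j) ∪ constants A I) x} := by
  ext x
  constructor
  · rintro ⟨p, rfl⟩
    induction p using Quotient.ind with
    | _ t =>
      change (P.pi I).InClosure _ (P.evalFamily A g (PolyTerm.mk P A t))
      induction t with
      | const c => exact .mem _ (Or.inr ⟨c, c.2, rfl⟩)
      | var j => exact .mem _ (Or.inl ⟨j, rfl⟩)
      | op t ih =>
        rw [← PolyTerm.op_mk, evalFamily_op]
        exact .op _ ih
      | skew t ih =>
        rw [evalFamily_mk_skew]
        exact .skew _ ih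
  · intro hx
    induction hx with
    | mem x hx =>
      rcases hx with ⟨j, rfl⟩ | hx
      · exact ⟨PolyTerm.mk P A (PTerm.var j), rfl⟩
      · exact P.constants_subset_range_evalFamily A g hx
    | op x _ ih =>
      choose p hp using ih
      exact ⟨PolyTerm.op p, by rw [evalFamily_op]; simp only [hp]⟩
    | skew x _ ih =>
      obtain ⟨p, rfl⟩ := ih
      induction p using Quotient.ind with
      | _ t => exact ⟨PolyTerm.mk P A t.skew, P.evalFamily_mk_skew A g t⟩

/-- If a family of points has the same radical as `Y`, evaluation at the family embeds `Γ(Y)`. -/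
theorem coordIso_range_evalFamily (Y : Set (Fin m → G)) (g : I → Fin m → G)
    (hY : ∀ p q, P.radical A Y p q ↔ P.evalFamily A g p = P.evalFamily A g q) :
    P.CoordIso A Y (Set.range (P.evalFamily A g)) := by
  -- One direction of `hY` makes `F` well defined, the other makes it injective.
  let F : P.Coord A Y → Set.range (P.evalFamily A g) :=
    Quotient.lift (fun p => ⟨P.evalFamily A g p, p, rfl⟩) fun p q h => Subtype.ext ((hY p q).1 h)
  have hF (p : PolyTerm P A m) : (F (Coord.mk P A Y p) : I → G) = P.evalFamily A g p := rfl
  have hbij : Function.Bijective F := by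
    constructor
    · intro c d h
      induction c using Quotient.ind with
      | _ p => induction d using Quotient.ind with
        | _ q => exact Quotient.sound ((hY p q).2 (congrArg Subtype.val h))
    · rintro ⟨_, p, rfl⟩
      exact ⟨Coord.mk P A Y p, rfl⟩
  refine ⟨Equiv.ofBijective F hbij, fun c => ?_, fun a => rfl⟩
  obtain ⟨p, rfl⟩ : ∃ p : Fin n → PolyTerm P A m, c = fun k => Coord.mk P A Y (p k) :=
    ⟨fun k => Quotient.out (c k), funext fun k => (Quotient.out_eq (c k)).symm⟩
  rw [Coord.op_mk]
  simp only [Equiv.ofBijective_apply, hF, evalFamily_op]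

/-- A subset of `G^I` generated over the constants by finitely many elements is the coordinate
polyadic group of the Zariski closure of the corresponding family of points. -/
theorem exists_coordIso_of_finitelyGenerated {K : Set (I → G)} (hne : K.Nonempty)
    (hK : (P.pi I).FinitelyGeneratedOver (constants A I) K) :
    ∃ (m : ℕ) (Y : Set (Fin m → G)), 0 < m ∧ P.IsAlgebraicSet A Y ∧ P.CoordIso A Y K := by
  obtain ⟨S, hS, rfl⟩ := hK
  obtain ⟨k₀, hk₀⟩ := hne
  -- A redundant generator is adjoined so that there is at least one variable.
  obtain ⟨r, s, hs⟩ := hS.fin_param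
  -- Transposing the matrix of generators turns generators in `G^I` into points of `G^m`, one for
  -- each `i`.
  let c : Fin (r + 1) → I → G := Fin.cons k₀ s
  let g : I → Fin (r + 1) → G := fun i j => c j i
  have hrange : Set.range (fun j i => g i j) = insert k₀ S := by
    change Set.range c = _
    rw [Fin.range_cons, hs.2]
  have hcl : {x | (P.pi I).InClosure (S ∪ constants A I) x} = Set.range (P.evalFamily A g) := by
    rw [range_evalFamily_eq_closure, hrange]
    ext x
    constructor
    · intro hx
      induction hx with
      | mem x hx => exact .mem _ (hx.imp_left (Set.mem_insert_of_mem _))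
      | op x _ ih => exact .op _ ih
      | skew x _ ih => exact .skew _ ih
    · intro hx
      induction hx with
      | mem x hx =>
        rcases hx with (rfl | hx) | hx
        exacts [hk₀, .mem _ (Or.inl hx), .mem _ (Or.inr hx)]
      | op x _ ih => exact .op _ ih
      | skew x _ ih => exact .skew _ ih
  -- The system consists of all equations valid at every `g i`. Each `g i` solves it, so pairs in
  -- the radical agree along the family; conversely, a pair agreeing along the family is itself one
  -- of the equations.
  refine ⟨r + 1, P.solutionSet A {e | P.evalFamily A g e.1 = P.evalFamily A g e.2},
    r.succ_pos, ⟨_, rfl⟩, ?_⟩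
  rw [hcl]
  refine P.coordIso_range_evalFamily A _ g fun p q => ⟨fun h => funext fun i => ?_, fun h y hy => ?_⟩
  · exact h (g i) fun e he => congrFun he i
  · exact hy (p, q) h

end Evaluation

end PolyadicGroup

/-! ### The two directions of the characterization. -/

theorem theorem5p2 {n : ℕ} {G : Type u} [Group G] (θ : MulAut G) (b : G)
    (hb : θ b = b) (hθ : ∀ x, (θ ^ (n - 1)) x = b * x * b⁻¹)
    (P : PolyadicGroup n G) (hP : ∀ x, P.op x = derOp n θ b x)
    (A : Set G) (hEN : P.EquationalNoetherian A) :
    (∀ (m : ℕ), 0 < m → ∀ Y : Set (Fin m → G), P.IsAlgebraicSet A Y →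
      ∃ (I : Type u) (u : I → G) (K : Set (I → G)),
        P.HasTwistedForm A θ u K ∧ P.CoordIso A Y K) ∧
    (∀ (I : Type w) (u : I → G) (K : Set (I → G)),
      P.HasTwistedForm A θ u K → (P.pi I).FinitelyGeneratedOver (PolyadicGroup.constants A I) K →
      ∃ (m : ℕ) (Y : Set (Fin m → G)), 0 < m ∧ P.IsAlgebraicSet A Y ∧ P.CoordIso A Y K) := by
  refine ⟨fun m hm Y _ => ?_, fun I u K hK hfg => ?_⟩
  -- The index set is `Y` itself, so agreeing along the family means agreeing on `Y`; any element of
  -- the image can serve as `u`.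
  · have hsub := P.range_evalFamily_isPolyadicSubgroup A hm (Subtype.val : Y → Fin m → G)
    obtain ⟨u, hu⟩ := hsub.1
    refine ⟨Y, u, _, ⟨hsub, P.constants_subset_range_evalFamily A _,
      hsub.isSubgroupOfTwist hP hu, fun h hh => hsub.twist_mem hP hu hh⟩,
      P.coordIso_range_evalFamily A Y _ fun p q => ⟨fun h => ?_, fun h g hg => ?_⟩⟩
    · exact funext fun y => h y y.2
    · exact congrFun h ⟨g, hg⟩
  · exact P.exists_coordIso_of_finitelyGenerated A hK.1.1 hfg
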